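/- Let $(H,(\cdot,\cdot))$ be a complex Hilbert space. A \emph{Kreĭn space} $(K,[\cdot,\cdot])$ is a complex vector space with a Hermitian sesquilinear form that admits a direct, $[\cdot,\cdot]$-orthogonal decomposition $K=K^+\oplus K^-$ such that $(K^+,[\cdot,\cdot])$ and $(K^-,-[\cdot,\cdot])$ are Hilbert spaces. With the projections $P^\pm$ onto $K^\pm$ put $J=P^+-P^-$ and $\{f,g\}=[Jf,g]$; the topology of $K$ is that of the Hilbert space $(K,\{\cdot,\cdot\})$. A densely defined operator $A$ in $K$ is J-self-adjoint (J-non-negative) if $JA$ is self-adjoint (non-negative) in $(K,\{\cdot,\cdot\})$; it is boundedly invertible if it maps $\operatorname{dom}A$ bijectively onto $K$ with bounded inverse. None of this depends on the chosen decomposition. A Kreĭn space $(K,[\cdot,\cdot])$ is a \emph{Kreĭn space completion} of an inner product space $(\widetilde K,[\cdot,\cdot]^\sim)$ if $\widetilde K$ is a dense subspace of $K$ and the two inner products coincide on $\widetilde K$. A densely defined symmetric sesquilinear form $\mathfrak t[\cdot,\cdot]$ in $H$ is \emph{closed} if for some $\lambda\in\mathbb R$, called a \emph{gap point}, $(\operatorname{dom}\mathfrak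 t,\mathfrak t_\lambda[\cdot,\cdot])$ with $\mathfrak t_\lambda[\cdot,\cdot]=\mathfrak t[\cdot,\cdot]-\lambda(\cdot,\cdot)$ is a Kreĭn space continuously embedded in $H$. A \emph{closure} of a form $\mathfrak s$ is a closed form $\mathfrak t$ extending $\mathfrak s$ such that $\operatorname{dom}\mathfrak s$ is dense in $(\operatorname{dom}\mathfrak t,\mathfrak t_\lambda[\cdot,\cdot])$ for some gap point $\lambda$ of $\mathfrak t$. The \emph{representing operator} $T_{\mathfrak t}$ of a closed form $\mathfrak t$ is the unique self-adjoint operator in $H$ with $\operatorname{dom}T_{\mathfrak t}\subset\operatorname{dom}\mathfrak t$ and $\mathfrak t[u,v]=(T_{\mathfrak t}u,v)$ for $u\in\operatorname{dom}T_{\mathfrak t}$, $v\in\operatorname{dom}\mathfrak t$. The \emph{range restriction} $A_{\mathfrak t}$ is the restriction of $T_{\mathfrak t}$ to $\operatorname{dom}A_{\mathfrak t}=T_{\mathfrak t}^{-1}(\operatorname{dom}\mathfrak t)$, regarded as an operator in $\operatorname{dom}\mathfrak t$. \textbf{Theorem.} Let $T$ be a self-adjoint and boundedly invertible operator in $H$.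 Let $\mathcal M_T$ be the set of all closures of the form $(T\cdot,\cdot)$, with domain $\operatorname{dom}T$, in $H$. Let $\mathcal N_T$ be the set of all triples $(K,[\cdot,\cdot],A)$ such that $(K,[\cdot,\cdot])$, with $K\subset H$, is a Kreĭn space completion of $(\operatorname{dom}T,(T\cdot,\cdot))$ that is continuously embedded in $H$, and $A=T|_{\operatorname{dom}A}$ with $\operatorname{dom}A=T^{-1}(K)$. Then: \begin{enumerate} \item The rule $\mathfrak t\mapsto(\operatorname{dom}\mathfrak t,\mathfrak t[\cdot,\cdot],A_{\mathfrak t})$ is a bijection from $\mathcal M_T$ onto $\mathcal N_T$. \item For every $(K,[\cdot,\cdot],A)\in\mathcal N_T$ the operator $A$ is J-non-negative, J-self-adjoint and boundedly invertible in the Kreĭn space $(K,[\cdot,\cdot])$. \item $\mathcal M_T$ is the set of all closed forms $\mathfrak t$ in $H$ with gap point $0$ and $T_{\mathfrak t}=T$; it is also the set of all closed forms $\mathfrak t$ in $H$ with $T_{\mathfrak t}=T$. \end{enumerate} -/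

import Mathlib

noncomputable section

/-! ### Kreĭn spaces

An inner product `[·,·]` on a complex vector space `K` is a sesquilinear form
`B : K →ₗ⋆[ℂ] K →ₗ[ℂ] ℂ`, conjugate-linear in the first variable (Mathlib's convention for
`inner`). -/

section KreinSpaces

variable {K : Type*} [AddCommGroup K] [Module ℂ K]

/-- `(L, [·,·])` is a Hilbert space: `[·,·]` is positive definite on `L`, and every sequence in `L`
which is Cauchy for the norm `[x, x] ^ (1 / 2)` converges in this norm to an element of `L`. -/
structure IsHilbertOn (B : K →ₗ⋆[ℂ] K →ₗ[ℂ] ℂ) (L : Submodule ℂ K) : Prop where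
  pos : ∀ x ∈ L, x ≠ 0 → 0 < (B x x).re
  complete : ∀ u : ℕ → K, (∀ n, u n ∈ L) →
    (∀ ε : ℝ, 0 < ε → ∃ N, ∀ m ≥ N, ∀ n ≥ N, √(B (u m - u n) (u m - u n)).re < ε) →
    ∃ x ∈ L, ∀ ε : ℝ, 0 < ε → ∃ N, ∀ n ≥ N, √(B (u n - x) (u n - x)).re < ε

/-- `K = P ⊕ M` is a fundamental decomposition of `(K, [·,·])`: the sum is direct and
`[·,·]`-orthogonal, `(P, [·,·])` is a Hilbert space, and `(M, [·,·])` is an anti-Hilbert space. -/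
structure IsFundamentalDecomposition (B : K →ₗ⋆[ℂ] K →ₗ[ℂ] ℂ) (P M : Submodule ℂ K) : Prop where
  isCompl : IsCompl P M
  orthogonal : ∀ x ∈ P, ∀ y ∈ M, B x y = 0
  hilbert : IsHilbertOn B P
  antiHilbert : IsHilbertOn (-B) M

/-- `(K, [·,·])` is a Kreĭn space. -/
def IsKreinSpace (B : K →ₗ⋆[ℂ] K →ₗ[ℂ] ℂ) : Prop :=
  B.IsSymm ∧ ∃ P M : Submodule ℂ K, IsFundamentalDecomposition B P M

/-- `J` is a fundamental symmetry: `J = P⁺ - P⁻` for the projections belonging to some fundamental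
decomposition. -/
def IsFundamentalSymmetry (B : K →ₗ⋆[ℂ] K →ₗ[ℂ] ℂ) (J : K →ₗ[ℂ] K) : Prop :=
  ∃ P M : Submodule ℂ K, IsFundamentalDecomposition B P M ∧
    (∀ x ∈ P, J x = x) ∧ (∀ x ∈ M, J x = -x)

/-- The Hilbert space inner product `{x, y} = [J x, y]`. -/
def jInner (B : K →ₗ⋆[ℂ] K →ₗ[ℂ] ℂ) (J : K →ₗ[ℂ] K) (x y : K) : ℂ := B (J x) y

/-- The Hilbert space norm `{x, x} ^ (1 / 2)`; it induces the topology of the Kreĭn space. -/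
def jNorm (B : K →ₗ⋆[ℂ] K →ₗ[ℂ] ℂ) (J : K →ₗ[ℂ] K) (x : K) : ℝ := √(jInner B J x x).re

/-- `D` is dense in the topology of the Kreĭn space `(K, [·,·])`. (The topology does not depend on
the fundamental symmetry; it is tested here with each of them.) -/
def KreinDense (B : K →ₗ⋆[ℂ] K →ₗ[ℂ] ℂ) (D : Set K) : Prop :=
  ∀ J, IsFundamentalSymmetry B J → ∀ x : K, ∀ ε : ℝ, 0 < ε → ∃ d ∈ D, jNorm B J (x - d) < ε

/-- `A` is J-self-adjoint in the Kreĭn space `(K, [·,·])`: it is densely defined, and `J A` is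
self-adjoint in the Hilbert space `(K, {·,·})`, i.e. `(g, k)` belongs to the graph of `J A` if and
only if `{J A f, g} = {f, k}` for all `f ∈ dom A`. -/
def IsJSelfAdjoint (B : K →ₗ⋆[ℂ] K →ₗ[ℂ] ℂ) (A : K →ₗ.[ℂ] K) : Prop :=
  KreinDense B (A.domain : Set K) ∧
  ∀ J, IsFundamentalSymmetry B J → ∀ g k : K,
    (∃ h : g ∈ A.domain, J (A ⟨g, h⟩) = k) ↔
      ∀ f : A.domain, jInner B J (J (A f)) g = jInner B J (f : K) k

/-- `A` is J-non-negative in the Kreĭn space `(K, [·,·])`: it is densely defined, and `J A` is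
non-negative in the Hilbert space `(K, {·,·})`. -/
def IsJNonneg (B : K →ₗ⋆[ℂ] K →ₗ[ℂ] ℂ) (A : K →ₗ.[ℂ] K) : Prop :=
  KreinDense B (A.domain : Set K) ∧
  ∀ J, IsFundamentalSymmetry B J → ∀ f : A.domain,
    0 ≤ (jInner B J (J (A f)) (f : K)).re ∧ (jInner B J (J (A f)) (f : K)).im = 0

/-- `A` is boundedly invertible in the Kreĭn space `(K, [·,·])`: it maps `dom A` bijectively onto
`K`, and the inverse is bounded. -/
def IsJBoundedlyInvertible (B : K →ₗ⋆[ℂ] K →ₗ[ℂ] ℂ) (A : K →ₗ.[ℂ] K) : Prop :=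
  Function.Bijective A ∧
  ∀ J, IsFundamentalSymmetry B J → ∃ C : ℝ, ∀ f : A.domain, jNorm B J (f : K) ≤ C * jNorm B J (A f)

/-- The triple `(K, [·,·], A)` belongs to the class `𝒩`: `(K, [·,·])` is a Kreĭn space and `A` is
J-non-negative, J-self-adjoint and boundedly invertible in it. -/
def MemClassN (B : K →ₗ⋆[ℂ] K →ₗ[ℂ] ℂ) (A : K →ₗ.[ℂ] K) : Prop :=
  IsKreinSpace B ∧ IsJNonneg B A ∧ IsJSelfAdjoint B A ∧ IsJBoundedlyInvertible B A

end KreinSpaces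

section Forms

variable {H : Type*} [NormedAddCommGroup H] [InnerProductSpace ℂ H]

/-- The Kreĭn space `(K, [·,·])`, where `K` is a subspace of the Hilbert space `H`, is continuously
embedded in `H`. -/
def ContinuouslyEmbedded {K : Submodule ℂ H} (B : K →ₗ⋆[ℂ] K →ₗ[ℂ] ℂ) : Prop :=
  ∀ J, IsFundamentalSymmetry B J → ∃ C : ℝ, ∀ x : K, ‖(x : H)‖ ≤ C * jNorm B J x

variable (H) in
/-- A densely defined symmetric sesquilinear form in `H`. -/
@[ext]
structure SymmForm where
  domain : Submodule ℂ H
  form : domain →ₗ⋆[ℂ] domain →ₗ[ℂ] ℂ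
  dense_domain : Dense (domain : Set H)
  symm : form.IsSymm

namespace SymmForm

/-- The inner product `𝔱_lam[·,·] = 𝔱[·,·] - lam (·,·)` on `dom 𝔱`. -/
def shift (t : SymmForm H) (lam : ℝ) : t.domain →ₗ⋆[ℂ] t.domain →ₗ[ℂ] ℂ :=
  t.form - (lam : ℂ) • (innerₛₗ ℂ : H →ₗ⋆[ℂ] H →ₗ[ℂ] ℂ).domRestrict₁₂ t.domain t.domain

/-- `lam` is a gap point of `𝔱`: `(dom 𝔱, 𝔱_lam)` is a Kreĭn space, continuously embedded in `H`. -/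
def IsGapPoint (t : SymmForm H) (lam : ℝ) : Prop :=
  IsKreinSpace (t.shift lam) ∧ ContinuouslyEmbedded (t.shift lam)

/-- A form is closed if it has a gap point. -/
def IsClosedForm (t : SymmForm H) : Prop := ∃ lam : ℝ, t.IsGapPoint lam

/-- `t` is an extension of `s`. -/
def Extends (t s : SymmForm H) : Prop :=
  ∃ h : s.domain ≤ t.domain, ∀ u v : s.domain, t.form ⟨u, h u.2⟩ ⟨v, h v.2⟩ = s.form u v

/-- `t` is a closure of `s`: a closed extension such that `dom s` is dense in the Kreĭn space
`(dom t, t_lam)` for some gap point `lam` of `t`. -/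
def IsClosureOf (t s : SymmForm H) : Prop :=
  t.IsClosedForm ∧ t.Extends s ∧
    ∃ lam : ℝ, t.IsGapPoint lam ∧ KreinDense (t.shift lam) {x | (x : H) ∈ s.domain}

variable [CompleteSpace H]

/-- `S` is the representing operator `T_𝔱` of `𝔱`: the (unique, see
`IsRepresentingOperator.unique`) self-adjoint operator with `dom S ⊆ dom 𝔱` and
`𝔱[u, v] = (S u, v)` for `u ∈ dom S`, `v ∈ dom 𝔱`. -/
def IsRepresentingOperator (t : SymmForm H) (S : H →ₗ.[ℂ] H) : Prop :=
  IsSelfAdjoint S ∧ ∃ h : S.domain ≤ t.domain,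
    ∀ (u : S.domain) (v : t.domain), t.form ⟨u, h u.2⟩ v = inner ℂ (S u) (v : H)

theorem IsRepresentingOperator.unique {t : SymmForm H} {S S' : H →ₗ.[ℂ] H}
    (hS : t.IsRepresentingOperator S) (hS' : t.IsRepresentingOperator S') : S = S' := by
  have key : ∀ {R R' : H →ₗ.[ℂ] H}, t.IsRepresentingOperator R → t.IsRepresentingOperator R' →
      R ≤ R' := by
    rintro R R' ⟨-, h, hr⟩ ⟨hsa', h', hr'⟩
    have hf : R'.IsFormalAdjoint R := by
      intro x y
      have h1 := hr' x ⟨y, h y.2⟩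
      have h2 := hr y ⟨x, h' x.2⟩
      have h3 := t.symm.eq ⟨y, h y.2⟩ ⟨x, h' x.2⟩
      rw [h1, h2] at h3
      rw [← h3]
      exact inner_conj_symm _ _
    have := LinearPMap.IsFormalAdjoint.le_adjoint hsa'.dense_domain hf
    rwa [LinearPMap.isSelfAdjoint_def.mp hsa'] at this
  exact le_antisymm (key hS hS') (key hS' hS)

open Classical in
/-- The representing operator `T_𝔱` of `𝔱` (with a junk value if there is none). -/
def representingOperator (t : SymmForm H) : H →ₗ.[ℂ] H :=
  if h : ∃ S, t.IsRepresentingOperator S then h.choose else ⊥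

theorem IsRepresentingOperator.eq {t : SymmForm H} {S : H →ₗ.[ℂ] H}
    (hS : t.IsRepresentingOperator S) : t.representingOperator = S := by
  have h : ∃ S, t.IsRepresentingOperator S := ⟨S, hS⟩
  rw [representingOperator, dif_pos h]
  exact h.choose_spec.unique hS

end SymmForm

/-- An operator `T` in `H` is boundedly invertible: it maps `dom T` bijectively onto `H`, and the
inverse is bounded. -/
def IsBoundedlyInvertible (T : H →ₗ.[ℂ] H) : Prop :=
  Function.Bijective T ∧ ∃ C : ℝ, ∀ f : T.domain, ‖(f : H)‖ ≤ C * ‖T f‖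

/-- The form `(T ·, ·)` with domain `dom T`, for a self-adjoint operator `T`. -/
def operatorForm [CompleteSpace H] (T : H →ₗ.[ℂ] H) (hT : IsSelfAdjoint T) : SymmForm H where
  domain := T.domain
  form := ((innerₛₗ ℂ : H →ₗ⋆[ℂ] H →ₗ[ℂ] ℂ).comp T.toFun).domRestrict₂ T.domain
  dense_domain := hT.dense_domain
  symm := ⟨fun x y => by
    have h := LinearPMap.adjoint_isFormalAdjoint hT.dense_domain
    rw [LinearPMap.isSelfAdjoint_def.mp hT] at h
    change (starRingEnd ℂ) (inner ℂ (T x) (y : H)) = inner ℂ (T y) (x : H)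
    rw [inner_conj_symm, h y x]⟩

/-- The restriction of an operator `S` in `H` to the range `K`, as an operator in `K`:
`dom A = {f ∈ K | f ∈ dom S, S f ∈ K}` and `A f = S f`. (If `dom S ⊆ K`, then
`dom A = S⁻¹(K)`.) -/
def rangeRestriction (S : H →ₗ.[ℂ] H) (K : Submodule ℂ H) : K →ₗ.[ℂ] K where
  domain :=
    { carrier := {f | ∃ h : (f : H) ∈ S.domain, S ⟨f, h⟩ ∈ K}
      zero_mem' := ⟨S.domain.zero_mem, by
        have : S ⟨((0 : K) : H), S.domain.zero_mem⟩ = 0 := S.map_zero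
        rw [this]; exact K.zero_mem⟩
      add_mem' := by
        rintro a b ⟨ha, ha'⟩ ⟨hb, hb'⟩
        refine ⟨S.domain.add_mem ha hb, ?_⟩
        have : S ⟨((a + b : K) : H), S.domain.add_mem ha hb⟩ = S ⟨a, ha⟩ + S ⟨b, hb⟩ :=
          S.map_add ⟨a, ha⟩ ⟨b, hb⟩
        rw [this]; exact K.add_mem ha' hb'
      smul_mem' := by
        rintro c a ⟨ha, ha'⟩
        refine ⟨S.domain.smul_mem c ha, ?_⟩
        have : S ⟨((c • a : K) : H), S.domain.smul_mem c ha⟩ = c • S ⟨a, ha⟩ :=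
          S.map_smul c ⟨a, ha⟩
        rw [this]; exact K.smul_mem c ha' }
  toFun :=
    { toFun := fun f => ⟨S ⟨((f : K) : H), f.2.1⟩, f.2.2⟩
      map_add' := fun a b => Subtype.ext (S.map_add ⟨((a : K) : H), a.2.1⟩ ⟨((b : K) : H), b.2.1⟩)
      map_smul' := fun c a => Subtype.ext (S.map_smul c ⟨((a : K) : H), a.2.1⟩) }

variable (H) in
/-- A triple `(K, [·,·], A)`: a subspace `K` of `H` with an inner product `[·,·]` on `K` and an
operator `A` in `K`. -/
structure SpaceTriple where
  space : Submodule ℂ H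
  form : space →ₗ⋆[ℂ] space →ₗ[ℂ] ℂ
  op : space →ₗ.[ℂ] space

/-- `(K, [·,·])` is a Kreĭn space completion of the inner product space `(dom s, s[·,·])`. -/
def IsKreinSpaceCompletion {K : Submodule ℂ H} (B : K →ₗ⋆[ℂ] K →ₗ[ℂ] ℂ) (s : SymmForm H) : Prop :=
  IsKreinSpace B ∧
  (∃ h : s.domain ≤ K, ∀ u v : s.domain, B ⟨u, h u.2⟩ ⟨v, h v.2⟩ = s.form u v) ∧
  KreinDense B {x | (x : H) ∈ s.domain}

variable [CompleteSpace H]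

/-- The rule `Φ`: `K = dom 𝔱`, `[·,·] = 𝔱[·,·]`, and `A = A_𝔱` is the restriction of the representing
operator `T_𝔱` to the range `dom 𝔱`. -/
def formToTriple (t : SymmForm H) : SpaceTriple H where
  space := t.domain
  form := t.form
  op := rangeRestriction t.representingOperator t.domain

/-- The set `ℳ_T` of all closures of `(T ·, ·)` in `H`. -/
def closuresOf (T : H →ₗ.[ℂ] H) (hT : IsSelfAdjoint T) : Set (SymmForm H) :=
  {t | t.IsClosureOf (operatorForm T hT)}

/-- The set `𝒩_T` of all `(K, [·,·], A)` where `(K, [·,·])` is a Kreĭn space completion of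
`(dom T, (T ·, ·))`, continuously embedded in `H`, and `A = T` on `dom A = T⁻¹(K)`. -/
def completionTriplesOf (T : H →ₗ.[ℂ] H) (hT : IsSelfAdjoint T) : Set (SpaceTriple H) :=
  {q | IsKreinSpaceCompletion q.form (operatorForm T hT) ∧ ContinuouslyEmbedded q.form ∧
    q.op = rangeRestriction T q.space}

end Forms

end

/-!
Relative to the Hilbert space inner product `{·,·}`, a Kreĭn space inner product is given by a
bounded, boundedly invertible, self-adjoint Gram operator `G`, and conversely every such `G` gives
a Kreĭn space: writing `G = |G|^(1/2) sign(G) |G|^(1/2)` reduces this to the involution `sign(G)`,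
whose eigenspaces for `1` and `-1` form a fundamental decomposition.

A surjective operator which is symmetric for `[·,·]` is automatically injective, densely defined and
J-self-adjoint, and its inverse is bounded by the Hellinger–Toeplitz theorem. If `[u, v] = (T u, v)`
on `dom T` and `T` is surjective, this applies to the range restriction `A` of `T`, because
`[A f, g] = (A f, A g) = [f, A g]`; the same identity shows that `A` is J-non-negative.

For a closed form `𝔱` with gap point `λ` and representing operator `T`, surjectivity of `T`
implies that the functionals `𝔱[u, ·]` and `𝔱_λ[u, ·]` run through the same subspace of the
algebraic dual of `dom 𝔱`. So `𝔱[u, v] = 𝔱_λ[R u, v]` for a linear bijection `R` of `dom 𝔱`. If `J`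
is a fundamental symmetry of `𝔱_λ`, then `J R` is bijective and symmetric, hence bounded, so it is
an admissible Gram operator for `𝔱`. Therefore `𝔱` is itself a Kreĭn space inner product, that is,
`0` is a gap point.
-/

open scoped InnerProductSpace

theorem completeSpace_of_isCompl_of_isOrtho {𝕜 E : Type*} [RCLike 𝕜] [NormedAddCommGroup E]
    [InnerProductSpace 𝕜 E] {P M : Submodule 𝕜 E} (h : IsCompl P M) (horth : P ⟂ M)
    (hP : IsComplete (P : Set E)) (hM : IsComplete (M : Set E)) : CompleteSpace E := by
  have : CompleteSpace P := hP.completeSpace_coe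
  have hMP : M = Pᗮ := eq_of_le_of_inf_le_of_sup_le (z := P) horth.symm
    (P.orthogonal_disjoint.symm.eq_bot.trans_le bot_le) (by simp [h.symm.sup_eq_top])
  have : CompleteSpace Pᗮ := (hMP ▸ hM).completeSpace_coe
  exact P.orthogonalDecomposition.toIsometryEquiv.completeSpace

section KreinSpaces

variable {K : Type*} [AddCommGroup K] [Module ℂ K] {B : K →ₗ⋆[ℂ] K →ₗ[ℂ] ℂ}

namespace IsHilbertOn

variable {L : Submodule ℂ K}

theorem re_apply_self_nonneg (h : IsHilbertOn B L) {x : K} (hx : x ∈ L) : 0 ≤ (B x x).re := by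
  rcases eq_or_ne x 0 with rfl | hx0
  · simp
  · exact (h.pos x hx hx0).le

theorem eq_zero_of_re_apply_self_eq_zero (h : IsHilbertOn B L) {x : K} (hx : x ∈ L)
    (hx0 : (B x x).re = 0) : x = 0 := by
  by_contra hne
  exact (h.pos x hx hne).ne' hx0

end IsHilbertOn

theorem isHilbertOn_iff_isComplete_map {E : Type*} [NormedAddCommGroup E] [Module ℂ E]
    {L : Submodule ℂ K} (f : K →ₗ[ℂ] E) (hf : ∀ x ∈ L, (B x x).re = ‖f x‖ ^ 2) :
    IsHilbertOn B L ↔ (∀ x ∈ L, f x = 0 → x = 0) ∧ IsComplete (L.map f : Set E) := by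
  have sqrt_eq_dist {x y : K} (hx : x ∈ L) (hy : y ∈ L) :
      √(B (x - y) (x - y)).re = dist (f x) (f y) := by
    rw [hf _ (L.sub_mem hx hy), Real.sqrt_sq (norm_nonneg _), map_sub, dist_eq_norm]
  refine ⟨fun h => ⟨fun x hx hfx => h.eq_zero_of_re_apply_self_eq_zero hx ?_, ?_⟩,
    fun ⟨hinj, hcomplete⟩ => ⟨fun x hx hx0 => ?_, fun u hu hcauchy => ?_⟩⟩
  · simp [hf x hx, hfx]
  · rw [← completeSpace_coe_iff_isComplete]
    refine Metric.complete_of_cauchySeq_tendsto fun v hv => ?_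
    choose u hu huv using fun n => (v n).2
    have dist_eq (n : ℕ) (x : K) (hx : x ∈ L) :
        dist (v n) ⟨f x, Submodule.mem_map_of_mem hx⟩ = √(B (u n - x) (u n - x)).re := by
      rw [sqrt_eq_dist (hu n) hx, huv, Subtype.dist_eq]
    obtain ⟨x, hx, hlim⟩ := h.complete u hu fun ε hε => by
      simpa only [sqrt_eq_dist (hu _) (hu _), huv, ← Subtype.dist_eq] using
        Metric.cauchySeq_iff.1 hv ε hε
    refine ⟨⟨f x, Submodule.mem_map_of_mem hx⟩, Metric.tendsto_atTop.2 fun ε hε => ?_⟩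
    simpa only [dist_eq _ x hx] using hlim ε hε
  · rw [hf x hx]
    exact pow_pos (norm_pos_iff.2 fun hfx => hx0 (hinj x hx hfx)) 2
  · have hfu : CauchySeq fun n => f (u n) := Metric.cauchySeq_iff.2 fun ε hε => by
      simpa only [sqrt_eq_dist (hu _) (hu _)] using hcauchy ε hε
    obtain ⟨_, ⟨x, hx, rfl⟩, hlim⟩ := cauchySeq_tendsto_of_isComplete hcomplete
      (fun n => Submodule.mem_map_of_mem (hu n)) hfu
    refine ⟨x, hx, fun ε hε => ?_⟩
    simpa only [sqrt_eq_dist (hu _) hx] using Metric.tendsto_atTop.1 hlim ε hε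

namespace IsFundamentalDecomposition

variable {P M : Submodule ℂ K}

theorem exists_add_eq (h : IsFundamentalDecomposition B P M) (x : K) :
    ∃ p m, p ∈ P ∧ m ∈ M ∧ p + m = x :=
  Submodule.codisjoint_iff_exists_add_eq.1 h.isCompl.codisjoint x

theorem exists_isFundamentalSymmetry (h : IsFundamentalDecomposition B P M) :
    ∃ J, IsFundamentalSymmetry B J := by
  refine ⟨P.projection M h.isCompl - M.projection P h.isCompl.symm, P, M, h, fun x hx => ?_,
    fun x hx => ?_⟩
  all_goals simp [Submodule.projection_apply_of_mem_left _ hx,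
    (Submodule.projection_apply_eq_zero_iff _).2 hx]

end IsFundamentalDecomposition

theorem IsKreinSpace.exists_isFundamentalSymmetry (h : IsKreinSpace B) :
    ∃ J, IsFundamentalSymmetry B J :=
  let ⟨_, _, hPM⟩ := h.2
  hPM.exists_isFundamentalSymmetry

namespace IsFundamentalSymmetry

variable {J : K →ₗ[ℂ] K}

theorem apply_apply (hJ : IsFundamentalSymmetry B J) (x : K) : J (J x) = x := by
  obtain ⟨P, M, h, hP, hM⟩ := hJ
  obtain ⟨p, m, hp, hm, rfl⟩ := h.exists_add_eq x
  simp [hP p hp, hM m hm]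

theorem apply_left_eq_apply_right (hJ : IsFundamentalSymmetry B J) (hB : B.IsSymm) (x y : K) :
    B (J x) y = B x (J y) := by
  obtain ⟨P, M, h, hP, hM⟩ := hJ
  obtain ⟨p, m, hp, hm, rfl⟩ := h.exists_add_eq x
  obtain ⟨q, n, hq, hn, rfl⟩ := h.exists_add_eq y
  have hpn : B p n = 0 := h.orthogonal p hp n hn
  have hmq : B m q = 0 := hB.eq_iff.1 (h.orthogonal q hq m hm)
  simp [hP p hp, hM m hm, hP q hq, hM n hn, hpn, hmq]

theorem jInner_self_pos (hJ : IsFundamentalSymmetry B J) (hB : B.IsSymm) {x : K} (hx : x ≠ 0) :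
    0 < (jInner B J x x).re := by
  obtain ⟨P, M, h, hP, hM⟩ := hJ
  obtain ⟨p, m, hp, hm, rfl⟩ := h.exists_add_eq x
  have hsplit : (jInner B J (p + m) (p + m)).re = (B p p).re + ((-B) m m).re := by
    have hpm : B p m = 0 := h.orthogonal p hp m hm
    have hmp : B m p = 0 := hB.eq_iff.1 hpm
    simp [jInner, hP p hp, hM m hm, hpm, hmp]
  have hp0 := h.hilbert.re_apply_self_nonneg hp
  have hm0 := h.antiHilbert.re_apply_self_nonneg hm
  rw [hsplit]
  refine (add_nonneg hp0 hm0).lt_of_ne' fun hsum => hx ?_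
  rw [h.hilbert.eq_zero_of_re_apply_self_eq_zero hp (by linarith),
    h.antiHilbert.eq_zero_of_re_apply_self_eq_zero hm (by linarith), add_zero]

theorem jInner_apply_left (hJ : IsFundamentalSymmetry B J) (x y : K) :
    jInner B J (J x) y = B x y := by
  rw [jInner, hJ.apply_apply]

theorem jInner_apply_right (hJ : IsFundamentalSymmetry B J) (hB : B.IsSymm) (x y : K) :
    jInner B J x (J y) = B x y := by
  rw [jInner, hJ.apply_left_eq_apply_right hB, hJ.apply_apply]

theorem jNorm_apply (hJ : IsFundamentalSymmetry B J) (hB : B.IsSymm) (x : K) :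
    jNorm B J (J x) = jNorm B J x := by
  rw [jNorm, jNorm, hJ.jInner_apply_right hB]
  rfl

end IsFundamentalSymmetry

/-- The space `K` regarded as the Hilbert space `(K, {·,·})` given by a fundamental symmetry `J`.
The proofs are arguments, so that the Hilbert space structure can be found by type class
inference. -/
@[nolint unusedArguments]
def JSpace {J : K →ₗ[ℂ] K} (_hB : B.IsSymm) (_hJ : IsFundamentalSymmetry B J) := K

section JSpace

variable {J : K →ₗ[ℂ] K} (hB : B.IsSymm) (hJ : IsFundamentalSymmetry B J)

instance : AddCommGroup (JSpace hB hJ) := inferInstanceAs (AddCommGroup K)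

instance : Module ℂ (JSpace hB hJ) := inferInstanceAs (Module ℂ K)

/-- The identity map from `K` to its Hilbert space copy `JSpace hB hJ`. -/
def toJSpace : K ≃ₗ[ℂ] JSpace hB hJ := LinearEquiv.refl ℂ K

/-- The inner product `{·,·}` on `JSpace hB hJ`. -/
@[reducible]
def jSpaceCore : InnerProductSpace.Core ℂ (JSpace hB hJ) where
  inner x y := jInner B J ((toJSpace hB hJ).symm x) ((toJSpace hB hJ).symm y)
  conj_inner_symm x y := by rw [jInner, jInner, hB.eq, hJ.apply_left_eq_apply_right hB]
  re_inner_nonneg x := by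
    rcases eq_or_ne ((toJSpace hB hJ).symm x) 0 with hx | hx
    · simp [hx, jInner]
    · exact (hJ.jInner_self_pos hB hx).le
  add_left x y z := by simp [jInner]
  smul_left x y r := by simp [jInner]
  definite x hx := by
    by_contra hne
    have hpos := hJ.jInner_self_pos hB ((toJSpace hB hJ).symm.map_ne_zero_iff.2 hne)
    simp [hx] at hpos

noncomputable instance : NormedAddCommGroup (JSpace hB hJ) :=
  (jSpaceCore hB hJ).toNormedAddCommGroup

noncomputable instance : InnerProductSpace ℂ (JSpace hB hJ) :=
  InnerProductSpace.ofCore (jSpaceCore hB hJ).toCore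

theorem inner_toJSpace (x y : K) : ⟪toJSpace hB hJ x, toJSpace hB hJ y⟫_ℂ = jInner B J x y := rfl

theorem norm_toJSpace (x : K) : ‖toJSpace hB hJ x‖ = jNorm B J x := rfl

theorem inner_toJSpace_apply_left (x y : K) :
    ⟪toJSpace hB hJ (J x), toJSpace hB hJ y⟫_ℂ = B x y := by
  rw [inner_toJSpace, hJ.jInner_apply_left]

instance : CompleteSpace (JSpace hB hJ) := by
  obtain ⟨P, M, h, hP, hM⟩ := id hJ
  have norm_sq (x : K) : ‖toJSpace hB hJ x‖ ^ 2 = (B (J x) x).re :=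
    (inner_self_eq_norm_sq (𝕜 := ℂ) (toJSpace hB hJ x)).symm
  have hPcomplete := ((isHilbertOn_iff_isComplete_map (toJSpace hB hJ).toLinearMap fun x hx => by
    simp [norm_sq, hP x hx]).1 h.hilbert).2
  have hMcomplete := ((isHilbertOn_iff_isComplete_map (toJSpace hB hJ).toLinearMap fun x hx => by
    simp [norm_sq, hM x hx]).1 h.antiHilbert).2
  refine completeSpace_of_isCompl_of_isOrtho
    (h.isCompl.map (Submodule.orderIsoMapComap (toJSpace hB hJ))) ?_ hPcomplete hMcomplete
  rw [Submodule.isOrtho_iff_inner_eq]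
  rintro _ ⟨p, hp, rfl⟩ _ ⟨m, hm, rfl⟩
  exact (inner_toJSpace hB hJ p m).trans (by rw [jInner, hP p hp, h.orthogonal p hp m hm])

end JSpace

theorem dense_image_toJSpace_iff {J : K →ₗ[ℂ] K} (hB : B.IsSymm) (hJ : IsFundamentalSymmetry B J)
    {D : Set K} :
    Dense (toJSpace hB hJ '' D) ↔ ∀ x, ∀ ε : ℝ, 0 < ε → ∃ d ∈ D, jNorm B J (x - d) < ε := by
  simp only [Dense, (toJSpace hB hJ).surjective.forall, Metric.mem_closure_iff, gt_iff_lt,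
    Set.exists_mem_image, dist_eq_norm, ← map_sub, norm_toJSpace]

namespace IsFundamentalSymmetry

variable {J : K →ₗ[ℂ] K}

theorem norm_apply_le_jNorm_mul_jNorm (hJ : IsFundamentalSymmetry B J) (hB : B.IsSymm) (x y : K) :
    ‖B x y‖ ≤ jNorm B J x * jNorm B J y := by
  rw [← inner_toJSpace_apply_left hB hJ, ← hJ.jNorm_apply hB x, ← norm_toJSpace hB hJ,
    ← norm_toJSpace hB hJ]
  exact norm_inner_le_norm _ _

theorem exists_apply_eq_of_bound (hJ : IsFundamentalSymmetry B J) (hB : B.IsSymm)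
    (f : K →ₗ[ℂ] ℂ) {C : ℝ} (hf : ∀ x, ‖f x‖ ≤ C * jNorm B J x) : ∃ z, B z = f := by
  let f' : JSpace hB hJ →L[ℂ] ℂ :=
    (f ∘ₗ (toJSpace hB hJ).symm.toLinearMap).mkContinuous C fun x => hf ((toJSpace hB hJ).symm x)
  let z := (toJSpace hB hJ).symm ((InnerProductSpace.toDual ℂ _).symm f')
  refine ⟨J z, LinearMap.ext fun x => ?_⟩
  exact InnerProductSpace.toDual_symm_apply (y := f') (x := toJSpace hB hJ x)

theorem exists_bound_of_symmetric (hJ : IsFundamentalSymmetry B J) (hB : B.IsSymm)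
    {R : K →ₗ[ℂ] K} (hR : ∀ x y, B (R x) y = B x (R y)) :
    ∃ C : ℝ, ∀ x, jNorm B J (R x) ≤ C * jNorm B J x := by
  let S : JSpace hB hJ →ₗ[ℂ] JSpace hB hJ := (toJSpace hB hJ).conj (J ∘ₗ R)
  have hS : S.IsSymmetric := fun a b => by
    obtain ⟨x, rfl⟩ := (toJSpace hB hJ).surjective a
    obtain ⟨y, rfl⟩ := (toJSpace hB hJ).surjective b
    simp only [S, LinearEquiv.conj_apply_apply, LinearEquiv.symm_apply_apply, LinearMap.comp_apply,
      inner_toJSpace, hJ.jInner_apply_left, hJ.jInner_apply_right hB, hR]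
  let S' : JSpace hB hJ →L[ℂ] JSpace hB hJ := ⟨S, hS.continuous⟩
  refine ⟨‖S'‖, fun x => ?_⟩
  rw [← hJ.jNorm_apply hB]
  exact S'.le_opNorm (toJSpace hB hJ x)

end IsFundamentalSymmetry

namespace IsKreinSpace

theorem separatingRight (h : IsKreinSpace B) : B.SeparatingRight := by
  intro x hx
  obtain ⟨J, hJ⟩ := h.exists_isFundamentalSymmetry
  by_contra hne
  have hpos := hJ.jInner_self_pos h.1 hne
  rw [jInner, hx, Complex.zero_re] at hpos
  exact hpos.false

theorem kreinDense_iff (h : IsKreinSpace B) {D : Submodule ℂ K} :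
    KreinDense B (D : Set K) ↔ ∀ x, (∀ d ∈ D, B d x = 0) → x = 0 := by
  have dense_iff (J : K →ₗ[ℂ] K) (hJ : IsFundamentalSymmetry B J) :
      Dense (toJSpace h.1 hJ '' D) ↔ ∀ x, (∀ d ∈ D, B d x = 0) → x = 0 := by
    have hsurj : Function.Surjective fun x => toJSpace h.1 hJ (J x) :=
      (toJSpace h.1 hJ).surjective.comp fun x => ⟨J x, hJ.apply_apply x⟩
    have eq_zero_iff (x : K) : toJSpace h.1 hJ (J x) = 0 ↔ x = 0 := by
      rw [LinearEquiv.map_eq_zero_iff]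
      exact ⟨fun hx => by rw [← hJ.apply_apply x, hx, map_zero], fun hx => by rw [hx, map_zero]⟩
    change Dense ((D.map (toJSpace h.1 hJ).toLinearMap : Submodule ℂ _) : Set (JSpace h.1 hJ)) ↔ _
    rw [Submodule.dense_iff_topologicalClosure_eq_top, Submodule.topologicalClosure_eq_top_iff,
      Submodule.eq_bot_iff, hsurj.forall]
    simp only [eq_zero_iff, Submodule.mem_orthogonal, Submodule.mem_map, LinearEquiv.coe_coe,
      forall_exists_index, and_imp, forall_apply_eq_imp_iff₂, inner_toJSpace,
      hJ.jInner_apply_right h.1]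
  obtain ⟨J, hJ⟩ := h.exists_isFundamentalSymmetry
  exact ⟨fun hD => (dense_iff J hJ).1 ((dense_image_toJSpace_iff h.1 hJ).2 (hD J hJ)),
    fun hD J hJ => (dense_image_toJSpace_iff h.1 hJ).1 ((dense_iff J hJ).2 hD)⟩

end IsKreinSpace

/-- The operator `A` in `K` is symmetric for `[·,·]`. Its domain is not required to be dense. -/
def IsJSymmetric (B : K →ₗ⋆[ℂ] K →ₗ[ℂ] ℂ) (A : K →ₗ.[ℂ] K) : Prop :=
  ∀ f g : A.domain, B (A f) g = B f (A g)

namespace IsJSymmetric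

variable {A : K →ₗ.[ℂ] K}

theorem injective_of_surjective (hA : IsJSymmetric B A) (hB : B.SeparatingRight)
    (hsurj : Function.Surjective A) : Function.Injective A := by
  refine (injective_iff_map_eq_zero A.toFun).2 fun f hf => Subtype.ext (hB f fun y => ?_)
  obtain ⟨g, rfl⟩ := hsurj y
  exact (hA g f).trans ((congrArg (B g) hf).trans (map_zero _))

theorem kreinDense_domain_of_surjective (hA : IsJSymmetric B A) (hB : IsKreinSpace B)
    (hsurj : Function.Surjective A) : KreinDense B (A.domain : Set K) := by
  refine hB.kreinDense_iff.2 fun x hx => ?_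
  obtain ⟨f, rfl⟩ := hsurj x
  have hf : (f : K) = 0 := hB.separatingRight f fun y => by
    obtain ⟨g, rfl⟩ := hsurj y
    rw [hA, hx g g.2]
  rw [(Subtype.ext hf : f = 0), A.map_zero]

theorem isJSelfAdjoint_of_surjective (hA : IsJSymmetric B A) (hB : IsKreinSpace B)
    (hsurj : Function.Surjective A) : IsJSelfAdjoint B A := by
  refine ⟨hA.kreinDense_domain_of_surjective hB hsurj, fun J hJ g k => ?_⟩
  simp only [hJ.jInner_apply_left]
  constructor
  · rintro ⟨h, rfl⟩ f
    rw [hJ.jInner_apply_right hB.1]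
    exact hA f ⟨g, h⟩
  · intro h
    obtain ⟨g₀, hg₀⟩ := hsurj (J k)
    have hg : g = g₀ := sub_eq_zero.1 <| hB.separatingRight _ fun y => by
      obtain ⟨f, rfl⟩ := hsurj y
      rw [map_sub, h, hA, hg₀, jInner, hJ.apply_left_eq_apply_right hB.1, sub_self]
    subst hg
    exact ⟨g₀.2, by rw [hg₀, hJ.apply_apply]⟩

theorem isJBoundedlyInvertible_of_surjective (hA : IsJSymmetric B A) (hB : IsKreinSpace B)
    (hsurj : Function.Surjective A) : IsJBoundedlyInvertible B A := by
  have hbij : Function.Bijective A := ⟨hA.injective_of_surjective hB.separatingRight hsurj, hsurj⟩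
  let inverse := (LinearEquiv.ofBijective A.toFun hbij).symm
  have apply_inverse (x : K) : A (inverse x) = x :=
    (LinearEquiv.ofBijective A.toFun hbij).apply_symm_apply x
  have inverse_apply (f : A.domain) : inverse (A f) = f :=
    (LinearEquiv.ofBijective A.toFun hbij).symm_apply_apply f
  refine ⟨hbij, fun J hJ => ?_⟩
  obtain ⟨C, hC⟩ := hJ.exists_bound_of_symmetric hB.1
    (R := A.domain.subtype ∘ₗ inverse.toLinearMap) fun x y => by
      have h := hA (inverse x) (inverse y)
      rw [apply_inverse, apply_inverse] at h
      exact h.symm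
  exact ⟨C, fun f => by simpa [inverse_apply] using hC (A f)⟩

end IsJSymmetric

end KreinSpaces

section GramOperator

theorem exists_involution_conj_eq {A : Type*} [Ring A] [StarRing A] [Algebra ℝ A]
    [TopologicalSpace A] [ContinuousFunctionalCalculus ℝ A IsSelfAdjoint] {a : A}
    (ha : IsSelfAdjoint a) (hu : IsUnit a) :
    ∃ s q : A, IsSelfAdjoint s ∧ IsSelfAdjoint q ∧ IsUnit q ∧ s * s = 1 ∧ q * s * q = a := by
  have ne_zero {x : ℝ} (hx : x ∈ spectrum ℝ a) : x ≠ 0 :=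
    ne_of_mem_of_not_mem hx (spectrum.zero_notMem ℝ hu)
  have hsign : ContinuousOn (fun x : ℝ => |x|⁻¹ * x) (spectrum ℝ a) :=
    (continuousOn_id.abs.inv₀ fun x hx => abs_ne_zero.2 (ne_zero hx)).mul continuousOn_id
  have hsqrt : ContinuousOn (fun x : ℝ => √|x|) (spectrum ℝ a) := by fun_prop
  refine ⟨cfc (fun x : ℝ => |x|⁻¹ * x) a, cfc (fun x : ℝ => √|x|) a, cfc_predicate _ _,
    cfc_predicate _ _, ?_, ?_, ?_⟩
  · rw [isUnit_cfc_iff _ a hsqrt]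
    exact fun x hx => (Real.sqrt_pos.2 (abs_pos.2 (ne_zero hx))).ne'
  · rw [← cfc_mul _ _ a hsign hsign, ← cfc_one ℝ a]
    refine cfc_congr fun x hx => ?_
    have := abs_ne_zero.2 (ne_zero hx)
    simp only [Pi.one_apply]
    field_simp
    exact (sq_abs x).symm
  · rw [← cfc_mul _ _ a hsqrt hsign, ← cfc_mul _ _ a (hsqrt.fun_mul hsign) hsqrt]
    conv_rhs => rw [← cfc_id ℝ a]
    refine cfc_congr fun x hx => ?_
    calc √|x| * (|x|⁻¹ * x) * √|x| = √|x| * √|x| * |x|⁻¹ * x := by ring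
      _ = x := by
        rw [Real.mul_self_sqrt (abs_nonneg x), mul_inv_cancel₀ (abs_ne_zero.2 (ne_zero hx)),
          one_mul]

theorem isCompl_eigenspace_one_neg_one {𝕜 V : Type*} [Field 𝕜] [NeZero (2 : 𝕜)] [AddCommGroup V]
    [Module 𝕜 V] {S : Module.End 𝕜 V} (hS : S * S = 1) :
    IsCompl (S.eigenspace 1) (S.eigenspace (-1)) := by
  have two_ne : (2 : 𝕜) ≠ 0 := NeZero.ne 2
  have S_apply_apply (x : V) : S (S x) = x := LinearMap.congr_fun hS x
  refine ⟨Module.End.disjoint_genEigenspace S ?_ 1 1,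
    Submodule.codisjoint_iff_exists_add_eq.2 fun x =>
      ⟨(2⁻¹ : 𝕜) • (x + S x), (2⁻¹ : 𝕜) • (x - S x), ?_, ?_, ?_⟩⟩
  · intro h
    exact two_ne (by rw [← one_add_one_eq_two, ← neg_eq_iff_add_eq_zero, ← h])
  · simp [S_apply_apply, add_comm]
  · simp [S_apply_apply, ← smul_neg]
  · rw [← smul_add, add_add_sub_cancel, ← two_smul 𝕜 x, inv_smul_smul₀ two_ne]

theorem exists_linearEquiv_apply_eq_of_range_eq {R S V V' W : Type*} [Semiring R] [Semiring S]
    [AddCommMonoid V] [AddCommMonoid V'] [AddCommMonoid W] [Module R V] [Module R V'] [Module S W]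
    {σ : R →+* S} {τ : S →+* R} [RingHomInvPair σ τ] [RingHomInvPair τ σ] {f : V →ₛₗ[σ] W}
    {g : V' →ₛₗ[σ] W} (hf : Function.Injective f) (hg : Function.Injective g)
    (hrange : f.range = g.range) : ∃ e : V' ≃ₗ[R] V, ∀ x, f (e x) = g x := by
  refine ⟨(LinearEquiv.ofInjective g hg).trans ((LinearEquiv.ofEq _ _ hrange.symm).trans
    (LinearEquiv.ofInjective f hf).symm), fun x => ?_⟩
  exact congrArg Subtype.val ((LinearEquiv.ofInjective f hf).apply_symm_apply _)

variable {K E : Type*} [AddCommGroup K] [Module ℂ K] [NormedAddCommGroup E]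
  [InnerProductSpace ℂ E] [CompleteSpace E] {B : K →ₗ⋆[ℂ] K →ₗ[ℂ] ℂ}

theorem isHilbertOn_comap (e : K ≃ₗ[ℂ] E) {L : Submodule ℂ E} (hL : IsClosed (L : Set E))
    (hB : ∀ x, e x ∈ L → B x x = ⟪e x, e x⟫_ℂ) : IsHilbertOn B (L.comap e.toLinearMap) := by
  refine (isHilbertOn_iff_isComplete_map e.toLinearMap fun x hx => ?_).2
    ⟨fun x _ hx => e.map_eq_zero_iff.1 hx, ?_⟩
  · rw [hB x hx]
    exact inner_self_eq_norm_sq (𝕜 := ℂ) _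
  · rw [Submodule.map_comap_eq_of_surjective e.surjective]
    exact hL.isComplete

theorem isKreinSpace_of_involution (e : K ≃ₗ[ℂ] E) {S : E →L[ℂ] E} (hS : IsSelfAdjoint S)
    (hSS : S * S = 1) (hB : ∀ x y, B x y = ⟪S (e x), e y⟫_ℂ) : IsKreinSpace B := by
  have hSsymm := hS.isSymmetric
  have apply_eq_self {a : E} (ha : a ∈ Module.End.eigenspace (S : E →ₗ[ℂ] E) 1) : S a = a := by
    simpa using ha
  have apply_eq_neg {a : E} (ha : a ∈ Module.End.eigenspace (S : E →ₗ[ℂ] E) (-1)) :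
      S a = -a := by
    simpa using ha
  have isClosed_eigenspace (c : ℂ) :
      IsClosed (Module.End.eigenspace (S : E →ₗ[ℂ] E) c : Set E) := by
    simp only [Module.End.eigenspace_def]
    exact ((S - algebraMap ℂ (E →L[ℂ] E) c).isClosed_ker :)
  refine ⟨⟨fun x y => ?_⟩, (Module.End.eigenspace S 1).comap e.toLinearMap,
    (Module.End.eigenspace S (-1)).comap e.toLinearMap, ?_, fun x hx y hy => ?_,
    isHilbertOn_comap e (isClosed_eigenspace 1) fun x hx => ?_,
    isHilbertOn_comap e (isClosed_eigenspace (-1)) fun x hx => ?_⟩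
  · rw [hB, hB, inner_conj_symm]
    exact (hSsymm _ _).symm
  · refine IsCompl.map (Submodule.orderIsoMapComap e).symm (isCompl_eigenspace_one_neg_one ?_)
    exact congrArg ContinuousLinearMap.toLinearMap hSS
  · rw [Submodule.mem_comap, LinearEquiv.coe_coe] at hx hy
    have h : ⟪S (e x), e y⟫_ℂ = ⟪e x, S (e y)⟫_ℂ := hSsymm _ _
    rw [apply_eq_self hx, apply_eq_neg hy, inner_neg_right] at h
    rw [hB, apply_eq_self hx]
    exact self_eq_neg.1 h
  · rw [hB, apply_eq_self hx]
  · rw [LinearMap.neg_apply, LinearMap.neg_apply, hB, apply_eq_neg hx, inner_neg_left, neg_neg]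

theorem isKreinSpace_of_isUnit (e : K ≃ₗ[ℂ] E) {G : E →L[ℂ] E} (hG : IsSelfAdjoint G)
    (hu : IsUnit G) (hB : ∀ x y, B x y = ⟪G (e x), e y⟫_ℂ) : IsKreinSpace B := by
  obtain ⟨S, Q, hS, hQ, hQu, hSS, rfl⟩ := exists_involution_conj_eq hG hu
  let Q' := LinearEquiv.ofBijective Q.toLinearMap (ContinuousLinearMap.isUnit_iff_bijective.1 hQu)
  refine isKreinSpace_of_involution (e.trans Q') hS hSS fun x y => ?_
  rw [hB]
  exact hQ.isSymmetric _ _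

theorem IsKreinSpace.of_linearEquiv {B' : K →ₗ⋆[ℂ] K →ₗ[ℂ] ℂ} (hB : IsKreinSpace B)
    (hB' : B'.IsSymm) (R : K ≃ₗ[ℂ] K) (hR : ∀ x, B (R x) = B' x) : IsKreinSpace B' := by
  obtain ⟨J, hJ⟩ := hB.exists_isFundamentalSymmetry
  let e := toJSpace hB.1 hJ
  let G : JSpace hB.1 hJ ≃ₗ[ℂ] JSpace hB.1 hJ :=
    e.symm.trans ((R.trans (LinearEquiv.ofInvolutive J hJ.apply_apply)).trans e)
  have inner_G (x y : K) : ⟪G (e x), e y⟫_ℂ = B' x y := by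
    rw [← hR, ← inner_toJSpace_apply_left hB.1 hJ]
    simp [G, e, LinearEquiv.ofInvolutive]
  have hG : G.toLinearMap.IsSymmetric := fun a b => by
    obtain ⟨x, rfl⟩ := e.surjective a
    obtain ⟨y, rfl⟩ := e.surjective b
    rw [← inner_conj_symm (e x)]
    simp only [LinearEquiv.coe_coe, inner_G, hB'.eq]
  let G' : JSpace hB.1 hJ →L[ℂ] JSpace hB.1 hJ := ⟨G, hG.continuous⟩
  exact isKreinSpace_of_isUnit e (G := G')
    (ContinuousLinearMap.isSelfAdjoint_iff_isSymmetric.2 hG)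
    (ContinuousLinearMap.isUnit_iff_bijective.2 G.bijective) fun x y => (inner_G x y).symm

theorem IsKreinSpace.of_range_eq {B' : K →ₗ⋆[ℂ] K →ₗ[ℂ] ℂ} (hB : IsKreinSpace B)
    (hB' : B'.IsSymm) (hrange : B'.range = B.range) : IsKreinSpace B' := by
  have injective_of_range_eq {F : K →ₗ⋆[ℂ] K →ₗ[ℂ] ℂ} (hF : F.IsSymm)
      (hFB : F.range = B.range) : Function.Injective F := by
    refine (injective_iff_map_eq_zero F).2 fun x hx => hB.separatingRight x fun y => ?_
    obtain ⟨z, hz⟩ : B y ∈ F.range := hFB ▸ LinearMap.mem_range_self B y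
    rw [← hz, ← hF.eq_iff, hx, LinearMap.zero_apply]
  obtain ⟨R, hR⟩ := exists_linearEquiv_apply_eq_of_range_eq (injective_of_range_eq hB.1 rfl)
    (injective_of_range_eq hB' hrange) hrange.symm
  exact hB.of_linearEquiv hB' R hR

end GramOperator

section Representation

variable {H : Type*} [NormedAddCommGroup H] [InnerProductSpace ℂ H] {K : Submodule ℂ H}
  {B : K →ₗ⋆[ℂ] K →ₗ[ℂ] ℂ} {T : H →ₗ.[ℂ] H}

theorem ContinuouslyEmbedded.exists_apply_eq_inner (hemb : ContinuouslyEmbedded B)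
    (hK : IsKreinSpace B) (y : H) : ∃ z : K, ∀ v : K, B z v = ⟪y, (v : H)⟫_ℂ := by
  obtain ⟨J, hJ⟩ := hK.exists_isFundamentalSymmetry
  obtain ⟨C, hC⟩ := hemb J hJ
  obtain ⟨z, hz⟩ := hJ.exists_apply_eq_of_bound hK.1 (innerₛₗ ℂ y ∘ₗ K.subtype) (C := ‖y‖ * C)
    fun v => calc
      ‖⟪y, (v : H)⟫_ℂ‖ ≤ ‖y‖ * ‖(v : H)‖ := norm_inner_le_norm _ _
      _ ≤ ‖y‖ * (C * jNorm B J v) := by gcongr; exact hC v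
      _ = ‖y‖ * C * jNorm B J v := (mul_assoc _ _ _).symm
  exact ⟨z, LinearMap.congr_fun hz⟩

/-- The inner product `[·,·]` on `K ⊆ H` is represented by the operator `T` in `H`:
`dom T ⊆ K` and `[u, v] = (T u, v)` for `u ∈ dom T`, `v ∈ K`. This is the notion of representing
operator without self-adjointness. -/
def IsRepresentedBy (B : K →ₗ⋆[ℂ] K →ₗ[ℂ] ℂ) (T : H →ₗ.[ℂ] H) : Prop :=
  ∃ h : T.domain ≤ K, ∀ (u : T.domain) (v : K), B ⟨u, h u.2⟩ v = ⟪T u, (v : H)⟫_ℂ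

namespace IsRepresentedBy

theorem apply_rangeRestriction (hB : IsRepresentedBy B T) (f : (rangeRestriction T K).domain)
    (v : K) : B f v = ⟪(rangeRestriction T K f : H), (v : H)⟫_ℂ :=
  hB.2 ⟨f, f.2.1⟩ v

theorem apply_rangeRestriction_left (hB : IsRepresentedBy B T) (hsymm : B.IsSymm)
    (f g : (rangeRestriction T K).domain) :
    B (rangeRestriction T K f) g =
      ⟪(rangeRestriction T K f : H), (rangeRestriction T K g : H)⟫_ℂ := by
  rw [← hsymm.eq, hB.apply_rangeRestriction, inner_conj_symm]

theorem isJSymmetric_rangeRestriction (hB : IsRepresentedBy B T) (hsymm : B.IsSymm) :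
    IsJSymmetric B (rangeRestriction T K) := fun f g => by
  rw [hB.apply_rangeRestriction_left hsymm, hB.apply_rangeRestriction]

theorem surjective_rangeRestriction (hB : IsRepresentedBy B T) (hT : Function.Surjective T) :
    Function.Surjective (rangeRestriction T K) := by
  intro y
  obtain ⟨u, hu⟩ := hT y
  exact ⟨⟨⟨u, hB.1 u.2⟩, u.2, hu ▸ y.2⟩, Subtype.ext hu⟩

theorem memClassN_rangeRestriction (hB : IsRepresentedBy B T) (hT : Function.Surjective T)
    (hK : IsKreinSpace B) : MemClassN B (rangeRestriction T K) := by
  have hsymm := hB.isJSymmetric_rangeRestriction hK.1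
  have hsurj := hB.surjective_rangeRestriction hT
  refine ⟨hK, ⟨hsymm.kreinDense_domain_of_surjective hK hsurj, fun J hJ f => ?_⟩,
    hsymm.isJSelfAdjoint_of_surjective hK hsurj,
    hsymm.isJBoundedlyInvertible_of_surjective hK hsurj⟩
  rw [hJ.jInner_apply_left, hB.apply_rangeRestriction_left hK.1]
  exact ⟨inner_self_nonneg (𝕜 := ℂ), inner_self_im (𝕜 := ℂ) _⟩

theorem kreinDense_domain (hB : IsRepresentedBy B T) (hT : Function.Surjective T)
    (hK : IsKreinSpace B) : KreinDense B {x : K | (x : H) ∈ T.domain} := by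
  intro J hJ x ε hε
  obtain ⟨d, hd, hlt⟩ := (hB.memClassN_rangeRestriction hT hK).2.1.1 J hJ x ε hε
  exact ⟨d, hd.1, hlt⟩

theorem continuouslyEmbedded (hB : IsRepresentedBy B T) (hT : Function.Surjective T)
    (hK : IsKreinSpace B) : ContinuouslyEmbedded B := by
  intro J hJ
  obtain ⟨C, hC⟩ := (hB.memClassN_rangeRestriction hT hK).2.2.2.2 J hJ
  refine ⟨√|C|, fun x => ?_⟩
  obtain ⟨f, hf⟩ := hB.surjective_rangeRestriction hT x
  have jNorm_nonneg : 0 ≤ jNorm B J x := Real.sqrt_nonneg _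
  have hsq : ‖(x : H)‖ ^ 2 ≤ |C| * jNorm B J x ^ 2 := calc
    ‖(x : H)‖ ^ 2 = ‖B f x‖ := by
      rw [hB.apply_rangeRestriction, hf, inner_self_eq_norm_sq_to_K]
      simp
    _ ≤ jNorm B J f * jNorm B J x := hJ.norm_apply_le_jNorm_mul_jNorm hK.1 _ _
    _ ≤ |C| * jNorm B J x * jNorm B J x := by
      have : jNorm B J f ≤ C * jNorm B J x := hf ▸ hC f
      gcongr
      exact this.trans (by gcongr; exact le_abs_self C)
    _ = |C| * jNorm B J x ^ 2 := by ring
  calc ‖(x : H)‖ ≤ √(|C| * jNorm B J x ^ 2) := Real.le_sqrt_of_sq_le hsq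
    _ = √|C| * jNorm B J x := by
      rw [Real.sqrt_mul (abs_nonneg C), Real.sqrt_sq jNorm_nonneg]

theorem isKreinSpaceCompletion [CompleteSpace H] (hB : IsRepresentedBy B T)
    (hsa : IsSelfAdjoint T) (hT : Function.Surjective T) (hK : IsKreinSpace B) :
    IsKreinSpaceCompletion B (operatorForm T hsa) :=
  ⟨hK, ⟨hB.1, fun u v => hB.2 u ⟨v, hB.1 v.2⟩⟩, hB.kreinDense_domain hT hK⟩

end IsRepresentedBy

end Representation

section ClosedForms

variable {H : Type*} [NormedAddCommGroup H] [InnerProductSpace ℂ H] {t s : SymmForm H}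
  {T : H →ₗ.[ℂ] H}

namespace SymmForm

theorem shift_apply (t : SymmForm H) (lam : ℝ) (u v : t.domain) :
    t.shift lam u v = t.form u v - lam * ⟪(u : H), (v : H)⟫_ℂ := rfl

theorem shift_zero (t : SymmForm H) : t.shift 0 = t.form := by
  refine LinearMap.ext fun u => LinearMap.ext fun v => ?_
  rw [shift_apply, Complex.ofReal_zero, zero_mul, sub_zero]

theorem isGapPoint_zero_iff :
    t.IsGapPoint 0 ↔ IsKreinSpace t.form ∧ ContinuouslyEmbedded t.form := by
  rw [IsGapPoint, shift_zero]

theorem isClosureOf_of_isKreinSpaceCompletion (h : IsKreinSpaceCompletion t.form s)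
    (hemb : ContinuouslyEmbedded t.form) : t.IsClosureOf s := by
  have hgap : t.IsGapPoint 0 := isGapPoint_zero_iff.2 ⟨h.1, hemb⟩
  exact ⟨⟨0, hgap⟩, h.2.1, 0, hgap, t.shift_zero.symm ▸ h.2.2⟩

theorem range_form_eq_range_shift {lam : ℝ} (hgap : t.IsGapPoint lam)
    (hrep : IsRepresentedBy t.form T) (hT : Function.Surjective T) :
    t.form.range = (t.shift lam).range := by
  apply le_antisymm
  · rintro _ ⟨u, rfl⟩
    obtain ⟨z, hz⟩ := hgap.2.exists_apply_eq_inner hgap.1 (u : H)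
    refine ⟨u + (lam : ℂ) • z, LinearMap.ext fun v => ?_⟩
    rw [map_add, map_smulₛₗ, LinearMap.add_apply, LinearMap.smul_apply, hz, shift_apply,
      Complex.conj_ofReal, smul_eq_mul, sub_add_cancel]
  · rintro _ ⟨w, rfl⟩
    obtain ⟨u, hu⟩ := hT w
    refine ⟨w - (lam : ℂ) • ⟨u, hrep.1 u.2⟩, LinearMap.ext fun v => ?_⟩
    rw [map_sub, map_smulₛₗ, LinearMap.sub_apply, LinearMap.smul_apply, hrep.2, hu, shift_apply,
      Complex.conj_ofReal, smul_eq_mul]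

theorem IsClosedForm.isGapPoint_zero (h : t.IsClosedForm) (hrep : IsRepresentedBy t.form T)
    (hT : Function.Surjective T) : t.IsGapPoint 0 := by
  obtain ⟨lam, hgap⟩ := h
  have hK := hgap.1.of_range_eq t.symm (range_form_eq_range_shift hgap hrep hT)
  exact isGapPoint_zero_iff.2 ⟨hK, hrep.continuouslyEmbedded hT hK⟩

variable [CompleteSpace H] {hsa : IsSelfAdjoint T}

theorem IsClosureOf.isRepresentedBy (h : t.IsClosureOf (operatorForm T hsa)) :
    IsRepresentedBy t.form T := by
  obtain ⟨-, ⟨hdom, hext⟩, lam, ⟨hK, hemb⟩, hdense⟩ := h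
  refine ⟨hdom, fun u => ?_⟩
  obtain ⟨z, hz⟩ := hemb.exists_apply_eq_inner hK (T u - (lam : ℂ) • (u : H))
  have hzu : ⟨u, hdom u.2⟩ - z = 0 := by
    refine (hK.kreinDense_iff (D := T.domain.comap t.domain.subtype)).1 hdense _ fun d hd => ?_
    have hform : t.form ⟨u, hdom u.2⟩ d = ⟪T u, (d : H)⟫_ℂ := hext u ⟨d, hd⟩
    rw [hK.1.eq_iff, map_sub, LinearMap.sub_apply, hz, shift_apply, hform, inner_sub_left,
      inner_smul_left, Complex.conj_ofReal, sub_self]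
  intro v
  have hv := hz v
  rw [← sub_eq_zero.1 hzu, shift_apply, inner_sub_left, inner_smul_left,
    Complex.conj_ofReal] at hv
  exact sub_left_injective hv

theorem isClosureOf_operatorForm_iff (hT : Function.Surjective T) :
    t.IsClosureOf (operatorForm T hsa) ↔ t.IsGapPoint 0 ∧ t.IsRepresentingOperator T := by
  refine ⟨fun h => ⟨h.1.isGapPoint_zero h.isRepresentedBy hT, hsa, h.isRepresentedBy⟩,
    fun ⟨hgap, _, hrep⟩ => ?_⟩
  obtain ⟨hK, hemb⟩ := isGapPoint_zero_iff.1 hgap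
  exact isClosureOf_of_isKreinSpaceCompletion
    (IsRepresentedBy.isKreinSpaceCompletion hrep hsa hT hK) hemb

theorem isGapPoint_zero_and_isRepresentingOperator_iff (hT : Function.Surjective T) :
    t.IsGapPoint 0 ∧ t.IsRepresentingOperator T ↔ t.IsClosedForm ∧ t.IsRepresentingOperator T :=
  ⟨fun ⟨hgap, hrep⟩ => ⟨⟨0, hgap⟩, hrep⟩,
    fun ⟨hclosed, hrep⟩ => ⟨hclosed.isGapPoint_zero hrep.2 hT, hrep⟩⟩

end SymmForm

theorem formToTriple_mem_completionTriplesOf [CompleteSpace H] {hsa : IsSelfAdjoint T}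
    (hT : Function.Surjective T) (ht : t ∈ closuresOf T hsa) :
    formToTriple t ∈ completionTriplesOf T hsa := by
  obtain ⟨hgap, hrep⟩ := (SymmForm.isClosureOf_operatorForm_iff hT).1 ht
  obtain ⟨hK, hemb⟩ := SymmForm.isGapPoint_zero_iff.1 hgap
  exact ⟨IsRepresentedBy.isKreinSpaceCompletion hrep.2 hsa hT hK, hemb,
    congrArg (rangeRestriction · t.domain) hrep.eq⟩

theorem formToTriple_injective [CompleteSpace H] :
    Function.Injective (formToTriple (H := H)) := by
  intro t t' h
  have hform : HEq (formToTriple t).form (formToTriple t').form := by rw [h]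
  exact SymmForm.ext (congrArg SpaceTriple.space h) hform

theorem exists_formToTriple_eq [CompleteSpace H] {hsa : IsSelfAdjoint T}
    (hT : Function.Surjective T) {q : SpaceTriple H} (hq : q ∈ completionTriplesOf T hsa) :
    ∃ t ∈ closuresOf T hsa, formToTriple t = q := by
  obtain ⟨K, B, A⟩ := q
  obtain ⟨hcompl, hemb, hA⟩ := hq
  let t : SymmForm H := ⟨K, B, hsa.dense_domain.mono hcompl.2.1.1, hcompl.1.1⟩
  have ht : t ∈ closuresOf T hsa := SymmForm.isClosureOf_of_isKreinSpaceCompletion hcompl hemb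
  have hop : (formToTriple t).op = A :=
    (formToTriple_mem_completionTriplesOf hT ht).2.2.trans hA.symm
  exact ⟨t, ht, congrArg (SpaceTriple.mk K B) hop⟩

theorem memClassN_of_mem_completionTriplesOf [CompleteSpace H] {hsa : IsSelfAdjoint T}
    (hT : Function.Surjective T) {q : SpaceTriple H} (hq : q ∈ completionTriplesOf T hsa) :
    MemClassN q.form q.op := by
  obtain ⟨t, ht, rfl⟩ := exists_formToTriple_eq hT hq
  have hrep := SymmForm.IsClosureOf.isRepresentedBy ht
  exact hq.2.2 ▸ hrep.memClassN_rangeRestriction hT hq.1.1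

end ClosedForms

theorem mainTheorem5 {H : Type*} [NormedAddCommGroup H] [InnerProductSpace ℂ H] [CompleteSpace H]
    (T : H →ₗ.[ℂ] H) (hT : IsSelfAdjoint T) (hTinv : IsBoundedlyInvertible T) :
    Set.BijOn formToTriple (closuresOf T hT) (completionTriplesOf T hT) ∧
    (∀ q ∈ completionTriplesOf T hT, MemClassN q.form q.op) ∧
    closuresOf T hT = {t | t.IsGapPoint 0 ∧ t.IsRepresentingOperator T} ∧
    closuresOf T hT = {t | t.IsClosedForm ∧ t.IsRepresentingOperator T} := by
  have hsurj : Function.Surjective T := hTinv.1.2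
  have closuresOf_eq : closuresOf T hT = {t | t.IsGapPoint 0 ∧ t.IsRepresentingOperator T} :=
    Set.ext fun _ => SymmForm.isClosureOf_operatorForm_iff hsurj
  refine ⟨⟨?_, formToTriple_injective.injOn, ?_⟩, ?_, closuresOf_eq, ?_⟩
  · exact fun t ht => formToTriple_mem_completionTriplesOf hsurj ht
  · exact fun q hq => exists_formToTriple_eq hsurj hq
  · exact fun q hq => memClassN_of_mem_completionTriplesOf hsurj hq
  · rw [closuresOf_eq]
    exact Set.ext fun t => SymmForm.isGapPoint_zero_and_isRepresentingOperator_iff hsurj
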